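/- Let $G=(V,E)$ be a finite directed acyclic graph. An edge $(i,j)\in E$ means that the output of $j$ enters the dynamics of $i$, and $\mathcal N_i=\{j:(i,j)\in E\}$ is the set of in-neighbours of $i$. Let $m_{i,j}\in\mathbb Z_{>0}$, $(i,j)\in E$, be delays, and let $\mathcal N^e\subseteq V$ be the set of excited nodes. Given node functions $\Phi_i:\mathbb R^{\mathcal N_i}\to\mathbb R$ ($i\in V$) and excitation signals $(u_i^k)_{k\in\mathbb Z}$, with $u_i\equiv 0$ for $i\notin\mathcal N^e$, the outputs are determined by $$y_i^k=u_i^{k-1}+\Phi_i\big((y_j^{k-m_{i,j}})_{j\in\mathcal N_i}\big),\qquad i\in V,\ k\in\mathbb Z .$$ All nodes are measured. The measured function $F_i$ of a node $i$ is $y_i^k-u_i^{k-1}$ as a function of the excitation signals. The class $\mathcal F_A$ consists of the functions $\mathbb R^m\to\mathbb R$ that are real analytic at every point. Node functions $\{\Phi_i\}\subset\mathcal F_A$ are called identifiable if every family $\{\tilde\Phi_i\}\subset\mathcal F_A$ of node functions on the same graph that has the same measured functions, $\tilde F_i=F_i$ for all $i\in V$, satisfies $\tilde\Phi_i=\Phi_i$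 for all $i\in V$. For an integer $K\ge1$, write a family of node functions in $\mathcal F_A$ as $$\Phi_i(y)=\sum_{j\in\mathcal N_i}f_{i,j}(y_j)+g_i(y),\qquad f_{i,j}(x)=\sum_{\ell=1}^{K}\alpha_{i,j}^{(\ell)}x^\ell+h_{i,j}(x),$$ where $h_{i,j}$ is real analytic on $\mathbb R$ and vanishes to order at least $K+1$ at $0$, and $g_i\in\mathcal F_A$ is constant on every coordinate axis (its Taylor series at $0$ contains only a constant and terms involving at least two variables). Let $P=(\alpha_{i,j}^{(\ell)})$ be the vector of the finitely many Taylor parameters $\alpha_{i,j}^{(\ell)}$, with $(i,j)\in E$ and $1\le\ell\le K$. **Theorem.** Suppose that the delays are path-independent: for every excited node $s$ and every node $i$, all directed paths from $s$ to $i$ have the same total delay. Suppose also that for every node $i$ there are mutually vertex-disjoint directed paths from excited nodes to the in-neighbours of $i$, one path to each in-neighbour (a path may consist of a single vertex). Then the network is generically identifiable in the class $\mathcal F_A$. That is, there is $K\ge1$ such that, for all $h_{i,j}$ and all $g_i$ as above, the node functions $\{\Phi_i\}$ are identifiable for all $P$ outside a set of Lebesgue measure zero. Moreover, for the same $K$,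 among node functions with $g_i(0)=0$ for all $i$, the set of measure zero can be chosen independently of the functions $h_{i,j}$ and $g_i$. -/

import Mathlib

/-- A network on the finite node set `V`: a directed acyclic graph, in which `graph.Adj j i` is the
arrow `j → i` (the output of `j` enters the dynamics of `i`), positive integer delays, and the set of
nodes that carry an excitation signal. Every node is measured. -/
structure Network (V : Type*) where
  /-- the known topology -/
  graph : Digraph V
  /-- there is no directed cycle -/
  acyclic : ∀ i, ¬ Relation.TransGen graph.Adj i i
  /-- `delay i j` is the delay `m_{i,j}` of the arrow `j → i` -/
  delay : V → V → ℕ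
  delay_pos : ∀ i j, graph.Adj j i → 0 < delay i j
  /-- the excited nodes -/
  excited : Set V

namespace Network

variable {V : Type*} (N : Network V)

/-- The in-neighbours of the node `i`. -/
def InNbr (i : V) : Type _ := {j : V // N.graph.Adj j i}

noncomputable instance [Finite V] (i : V) : Fintype (N.InNbr i) :=
  haveI : Finite (N.InNbr i) := inferInstanceAs (Finite {j : V // N.graph.Adj j i})
  Fintype.ofFinite _

noncomputable instance (i : V) : DecidableEq (N.InNbr i) := Classical.decEq _

theorem wellFounded_adj [Finite V] : WellFounded N.graph.Adj := by
  have : IsTrans V (Relation.TransGen N.graph.Adj) := ⟨fun _ _ _ => Relation.TransGen.trans⟩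
  have : Std.Irrefl (Relation.TransGen N.graph.Adj) := ⟨N.acyclic⟩
  exact Subrelation.wf (fun h => Relation.TransGen.single h)
    (Finite.wellFounded_of_trans_of_irrefl (Relation.TransGen N.graph.Adj))

/-! ### Paths -/

/-- `p` is the list of vertices of a directed path from `s` to `t` (a single vertex is a path). -/
def IsPath (p : List V) (s t : V) : Prop :=
  p.IsChain N.graph.Adj ∧ p.Nodup ∧ p.head? = some s ∧ p.getLast? = some t

/-- The sum of the delays of the arrows along a list of vertices. -/
def pathDelay : List V → ℕ
  | [] => 0
  | [_] => 0
  | a :: b :: l => N.delay b a + pathDelay (b :: l)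

/-- Path-independent delays: all the paths from an excited node to a given node have the same total
delay. -/
def PathIndependentDelay : Prop :=
  ∀ s ∈ N.excited, ∀ (i : V) (p q : List V), N.IsPath p s i → N.IsPath q s i →
    N.pathDelay p = N.pathDelay q

/-- There are mutually vertex-disjoint paths from excited nodes to the in-neighbours of `i`, one
path to each in-neighbour. -/
def HasVertexDisjointPaths (i : V) : Prop :=
  ∃ p : N.InNbr i → List V,
    (∀ j, ∃ s ∈ N.excited, N.IsPath (p j) s j.1) ∧
    ∀ j j', j ≠ j' → (p j).Disjoint (p j')

/-! ### Dynamics and measured functions -/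

/-- A set of node functions: `Φ i` is a function of the outputs of the in-neighbours of `i`. -/
abbrev NodeFunctions : Type _ := (i : V) → (N.InNbr i → ℝ) → ℝ

/-- The class of analytic functions `ℝ^m → ℝ`: a convergent power series at every point. -/
def _root_.IsClassFA {ι : Type*} [Fintype ι] (φ : (ι → ℝ) → ℝ) : Prop :=
  AnalyticOnNhd ℝ φ Set.univ

/-- Excitation signals of the excited nodes, in discrete time. -/
abbrev Excitation : Type _ := N.excited → ℤ → ℝ

open Classical in
/-- The excitation signals on all nodes: zero at the nodes that are not excited. -/
noncomputable def input (u : N.Excitation) (i : V) (k : ℤ) : ℝ :=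
  if h : i ∈ N.excited then u ⟨i, h⟩ k else 0

/-- The output `y_i^k`, by recursion along the acyclic graph; see `output_eq`. -/
noncomputable def output [Finite V] (Φ : N.NodeFunctions) (u : N.Excitation) : V → ℤ → ℝ :=
  N.wellFounded_adj.fix fun i y k =>
    N.input u i (k - 1) + Φ i fun j => y j.1 j.2 (k - N.delay i j.1)

/-- The dynamics `y_i^k = u_i^{k-1} + Φ_i ((y_j^{k-m_{i,j}})_j)`. -/
theorem output_eq [Finite V] (Φ : N.NodeFunctions) (u : N.Excitation) (i : V) (k : ℤ) :
    N.output Φ u i k =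
      N.input u i (k - 1) + Φ i fun j => N.output Φ u j.1 (k - N.delay i j.1) := by
  unfold output
  rw [WellFounded.fix_eq]

/-- The measured function `F_i`: the output of `i` minus `u_i^{k-1}`, as a function of the
excitation signals (and of the instant `k` at which it is evaluated). -/
noncomputable def measured [Finite V] (Φ : N.NodeFunctions) (i : V) (u : N.Excitation) (k : ℤ) : ℝ :=
  N.output Φ u i k - N.input u i (k - 1)

/-- The node functions `Φ` are determined, among all analytic node functions on the same graph, by
the measured functions of all the nodes. -/
def Identifiable [Finite V] (Φ : N.NodeFunctions) : Prop :=
  ∀ Ψ : N.NodeFunctions, (∀ i, IsClassFA (Ψ i)) → N.measured Ψ = N.measured Φ → Ψ = Φ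

/-! ### Parametrization and genericity -/

/-- The parameters `α_{i,j}^{(ℓ)}`, `1 ≤ ℓ ≤ K`; the entry with index `l : Fin K` is the one with
`ℓ = l + 1`. -/
abbrev Params (K : ℕ) : Type _ := (i : V) → N.InNbr i → Fin K → ℝ

/-- The part of an analytic node function family that is not a parameter: for each arrow `j → i` the
sum `tail i j` of the terms of degree at least `K + 1` of the univariate function `f_{i,j}`, and for
each node the function `mixed i = g_i`, which is analytic and has no term that depends on exactly
one variable (so that it is constant on each coordinate axis). -/
structure Remainder [Finite V] (K : ℕ) where
  tail : (i : V) → N.InNbr i → ℝ → ℝ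
  tail_analytic : ∀ i j, AnalyticOnNhd ℝ (tail i j) Set.univ
  tail_order : ∀ i j, ∀ l ≤ K, iteratedDeriv l (tail i j) 0 = 0
  mixed : N.NodeFunctions
  mixed_analytic : ∀ i, IsClassFA (mixed i)
  mixed_axis : ∀ i (j : N.InNbr i) (t : ℝ), mixed i (Pi.single j t) = mixed i 0

/-- The node functions `Φ_i (y) = ∑_j f_{i,j} (y_j) + g_i (y)` with
`f_{i,j} (x) = ∑_{ℓ=1}^K α_{i,j}^{(ℓ)} x^ℓ + tail_{i,j} (x)`. -/
noncomputable def nodeFunctions [Finite V] {K : ℕ} (R : N.Remainder K) (α : N.Params K) :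
    N.NodeFunctions :=
  fun i y =>
    ∑ j, (∑ l : Fin K, α i j l * y j ^ (l.1 + 1) + R.tail i j (y j)) + R.mixed i y

/-- For all remaining coefficients, the network is identifiable for all parameters `α` outside a set
of Lebesgue measure zero. -/
def KGenericallyIdentifiable [Fintype V] (K : ℕ) : Prop :=
  ∀ R : N.Remainder K, ∀ᵐ α : N.Params K, N.Identifiable (N.nodeFunctions R α)

/-- The same with one set of measure zero for all remaining coefficients, for node functions without
a constant term. -/
def UniformlyKGenericallyIdentifiable [Fintype V] (K : ℕ) : Prop :=
  ∀ᵐ α : N.Params K, ∀ R : N.Remainder K, (∀ i, R.mixed i 0 = 0) →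
    N.Identifiable (N.nodeFunctions R α)

end Network

/-! Excitations constant in time give outputs constant in time, so the delays drop out and the
network becomes a static map. Equal measured functions mean equal outputs, so two candidate
functions for node `i` agree at every vector of in-neighbour outputs attained by such excitations.
If the derivative of the excitation-to-output map at zero excitation is onto, these vectors fill an
open set, and analyticity extends the agreement everywhere (`identifiable_of_det_ne_zero`).

That derivative is the transfer matrix of the linearized network. Its determinant is analytic in the
linear coefficients (hence `K = 1`), so it vanishes only on a null set unless it vanishes
identically. Unit gains along the disjoint paths, with all other gains zero, make the matrix the
identity (`exists_gain_transfer_det_ne_zero`), and all gains are attainable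
(`exists_gain_nodeFunctions_eq`). If `g_i(0) = 0`, zero excitation gives zero outputs and the gains
are the coefficients themselves, so the null set does not depend on the remainder. -/

open MeasureTheory Set

/-! ### Zero sets of analytic functions -/

/-- The zeros of a nonzero analytic function on a Euclidean space form a null set. -/
theorem ae_ne_zero_of_analyticOnNhd_fin (n : ℕ) (f : (Fin n → ℝ) → ℝ)
    (hf : AnalyticOnNhd ℝ f univ) (hne : ∃ x, f x ≠ 0) : ∀ᵐ x, f x ≠ 0 := by
  induction n with
  | zero =>
    obtain ⟨x, hx⟩ := hne
    exact Filter.Eventually.of_forall fun y => by rwa [Subsingleton.elim y x]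
  | succ n ih =>
    let c : ℝ × (Fin n → ℝ) →L[ℝ] (Fin (n + 1) → ℝ) :=
      LinearMap.toContinuousLinearMap
        { toFun := fun p => Fin.cons p.1 p.2
          map_add' := fun p q => by ext k; refine Fin.cases ?_ (fun k => ?_) k <;> simp
          map_smul' := fun r p => by ext k; refine Fin.cases ?_ (fun k => ?_) k <;> simp }
    have hc : ∀ p, c p = Fin.cons p.1 p.2 := fun _ => rfl
    have hg : ∀ p, AnalyticAt ℝ (fun p => f (c p)) p := fun p =>
      (hf (c p) (mem_univ _)).comp (c.analyticAt p)
    have hcont : Continuous fun p => f (c p) :=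
      continuous_iff_continuousAt.2 fun p => (hg p).continuousAt
    -- Fubini: for almost every first coordinate the slice is not identically zero, and the
    -- induction hypothesis applies to it.
    have key : ∀ᵐ p : ℝ × (Fin n → ℝ), f (c p) ≠ 0 := by
      have hm : MeasurableSet {p : ℝ × (Fin n → ℝ) | f (c p) ≠ 0} :=
        (hcont.measurable (measurableSet_singleton 0)).compl
      refine (Measure.ae_prod_mem_iff_ae_ae_mem hm).2 ?_
      obtain ⟨x, hx⟩ := hne
      have hx' : f (c (x 0, Fin.tail x)) ≠ 0 := by simpa [hc] using hx
      have h1 : ∀ᵐ a : ℝ, f (c (a, Fin.tail x)) ≠ 0 := by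
        have ha : AnalyticOnNhd ℝ (fun a : ℝ => f (c (a, Fin.tail x))) univ := fun a _ =>
          (hg (a, Fin.tail x)).comp (f := fun a : ℝ => (a, Fin.tail x))
            (analyticAt_id.prod analyticAt_const)
        rcases ha.eqOn_zero_or_eventually_ne_zero_of_preconnected isPreconnected_univ with h | h
        · exact absurd (h (mem_univ (x 0))) hx'
        · have h' := ae_restrict_le_codiscreteWithin (μ := volume) MeasurableSet.univ h
          rwa [Measure.restrict_univ] at h'
      filter_upwards [h1] with a ha
      exact ih (fun b => f (c (a, b)))
        (fun b _ => (hg (a, b)).comp (f := fun b : Fin n → ℝ => (a, b))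
          (analyticAt_const.prod analyticAt_id)) ⟨_, ha⟩
    have hmp := volume_preserving_piFinSuccAbove (fun _ : Fin (n + 1) => ℝ) 0
    filter_upwards [hmp.quasiMeasurePreserving.ae key] with x hx
    convert hx using 2
    ext k
    refine Fin.cases ?_ (fun k => ?_) k <;> simp [hc, MeasurableEquiv.piFinSuccAbove, Fin.tail]

/-- The zeros of a nonzero analytic function on a finite-dimensional space form a null set. -/
theorem ae_ne_zero_of_analyticOnNhd {E : Type*} [NormedAddCommGroup E] [NormedSpace ℝ E]
    [FiniteDimensional ℝ E] [MeasurableSpace E] [BorelSpace E] (μ : Measure E)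
    [μ.IsAddHaarMeasure] {f : E → ℝ} (hf : AnalyticOnNhd ℝ f univ) (hne : ∃ x, f x ≠ 0) :
    ∀ᵐ x ∂μ, f x ≠ 0 := by
  let L : E ≃L[ℝ] (Fin (Module.finrank ℝ E) → ℝ) :=
    ContinuousLinearEquiv.ofFinrankEq (by simp)
  have h := ae_ne_zero_of_analyticOnNhd_fin _ (fun x => f (L.symm x))
    (fun x _ => (hf _ (mem_univ _)).comp (L.symm.toContinuousLinearMap.analyticAt x))
    (by obtain ⟨x, hx⟩ := hne; exact ⟨L x, by simpa using hx⟩)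
  have h2 := (Measure.absolutelyContinuous_isAddHaarMeasure (μ.map L) volume).ae_le h
  have h3 := ae_of_ae_map L.continuous.measurable.aemeasurable h2
  simpa using h3

namespace Network

variable {V : Type*} (N : Network V)

/-! ### Static response and its linearization -/

/-- The outputs of the network for excitations `z` that are constant in time. -/
noncomputable def staticOutput [Finite V] (Φ : N.NodeFunctions) (z : V → ℝ) : V → ℝ :=
  N.wellFounded_adj.fix fun i y => z i + Φ i fun j => y j.1 j.2

theorem staticOutput_eq [Finite V] (Φ : N.NodeFunctions) (z : V → ℝ) (i : V) :
    N.staticOutput Φ z i = z i + Φ i fun j => N.staticOutput Φ z j.1 := by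
  unfold staticOutput
  rw [WellFounded.fix_eq]

theorem eq_staticOutput [Finite V] {Φ : N.NodeFunctions} {z y : V → ℝ}
    (h : ∀ i, y i = z i + Φ i fun j => y j.1) : y = N.staticOutput Φ z := by
  funext i
  induction i using N.wellFounded_adj.induction with
  | _ i ih =>
    rw [h, staticOutput_eq]
    congr 2
    funext j
    exact ih j.1 j.2

theorem output_const [Finite V] (Φ : N.NodeFunctions) {z : V → ℝ}
    (hz : ∀ i, i ∉ N.excited → z i = 0) (i : V) (k : ℤ) :
    N.output Φ (fun s _ => z s.1) i k = N.staticOutput Φ z i := by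
  induction i using N.wellFounded_adj.induction generalizing k with
  | _ i ih =>
    rw [output_eq, staticOutput_eq]
    congr 1
    · unfold input
      split_ifs with h
      · rfl
      · exact (hz i h).symm
    · congr 1
      funext j
      exact ih j.1 j.2 _

/-- The response of the linear network with gains `W` to the excitations `e`, which may take values
in any module. -/
noncomputable def linearResponse [Finite V] {M : Type*} [AddCommGroup M] [Module ℝ M]
    (W : ∀ i, N.InNbr i → ℝ) (e : V → M) : V → M :=
  N.wellFounded_adj.fix fun i y => e i + ∑ j : N.InNbr i, W i j • y j.1 j.2

section LinearResponse

variable [Finite V] {M : Type*} [AddCommGroup M] [Module ℝ M]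

theorem linearResponse_eq (W : ∀ i, N.InNbr i → ℝ) (e : V → M) (i : V) :
    N.linearResponse W e i = e i + ∑ j : N.InNbr i, W i j • N.linearResponse W e j.1 := by
  unfold linearResponse
  rw [WellFounded.fix_eq]

/-- Turns the response to coefficient vectors into the response to the functionals they represent,
linking `transfer` to the derivative. -/
theorem map_linearResponse {M' : Type*} [AddCommGroup M'] [Module ℝ M'] (T : M →ₗ[ℝ] M')
    (W : ∀ i, N.InNbr i → ℝ) (e : V → M) (i : V) :
    T (N.linearResponse W e i) = N.linearResponse W (fun v => T (e v)) i := by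
  induction i using N.wellFounded_adj.induction with
  | _ i ih =>
    rw [linearResponse_eq, N.linearResponse_eq W (fun v => T (e v)), map_add, map_sum]
    congr 1
    refine Finset.sum_congr rfl fun j _ => ?_
    rw [map_smul, ih j.1 j.2]

end LinearResponse

theorem analyticAt_linearResponse [Finite V] {M : Type*} [NormedAddCommGroup M] [NormedSpace ℝ M]
    {X : Type*} [NormedAddCommGroup X] [NormedSpace ℝ X] {W : X → ∀ i, N.InNbr i → ℝ} {x : X}
    (hW : ∀ i j, AnalyticAt ℝ (fun x => W x i j) x) (e : V → M) (i : V) :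
    AnalyticAt ℝ (fun x => N.linearResponse (W x) e i) x := by
  induction i using N.wellFounded_adj.induction with
  | _ i ih =>
    simp_rw [N.linearResponse_eq _ _ i]
    exact analyticAt_const.add
      (Finset.analyticAt_fun_sum _ fun j _ => (hW i j).smul (ih j.1 j.2))

/-- The partial derivatives of the node functions at the outputs for the constant excitations `z`. -/
noncomputable def gain [Finite V] (Φ : N.NodeFunctions) (z : V → ℝ) : ∀ i, N.InNbr i → ℝ :=
  fun i j => fderiv ℝ (Φ i) (fun j => N.staticOutput Φ z j.1) (Pi.single j 1)

/-- Differentiating the output recursion by the chain rule gives the recursion of the linear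
network. Strictness serves the open mapping argument. -/
theorem hasStrictFDerivAt_staticOutput [Finite V] {Φ : N.NodeFunctions} (hΦ : ∀ i, IsClassFA (Φ i))
    {X : Type*} [NormedAddCommGroup X] [NormedSpace ℝ X] (e : V → X →L[ℝ] ℝ) (x : X) (i : V) :
    HasStrictFDerivAt (fun x => N.staticOutput Φ (fun v => e v x) i)
      (N.linearResponse (N.gain Φ fun v => e v x) e i) x := by
  induction i using N.wellFounded_adj.induction with
  | _ i ih =>
    simp_rw [N.staticOutput_eq _ _ i]
    rw [linearResponse_eq]
    refine (e i).hasStrictFDerivAt.add ?_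
    have h1 := (hΦ i (fun j => N.staticOutput Φ (fun v => e v x) j.1) (mem_univ _)).hasStrictFDerivAt
    have h2 : HasStrictFDerivAt (fun x => fun j : N.InNbr i => N.staticOutput Φ (fun v => e v x) j.1)
        (ContinuousLinearMap.pi fun j : N.InNbr i =>
          N.linearResponse (N.gain Φ fun v => e v x) e j.1) x :=
      hasStrictFDerivAt_pi'.2 fun j => ih j.1 j.2
    refine (h1.comp x h2).congr_fderiv ?_
    ext w
    simp only [ContinuousLinearMap.comp_apply, sum_apply,
      smul_apply]
    conv_lhs => rw [pi_eq_sum_univ' (ContinuousLinearMap.pi _ w), map_sum]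
    refine Finset.sum_congr rfl fun j _ => ?_
    rw [map_smul, smul_eq_mul, smul_eq_mul, mul_comm]
    congr 2

/-! ### Identifiability from a nonsingular transfer matrix -/

/-- The transfer gains, in the linear network with gains `W`, from the excitations at the nodes
`s a` to each of the nodes. -/
noncomputable def transfer [Finite V] {ι : Type*} (s : ι → V) (W : ∀ i, N.InNbr i → ℝ) :
    V → ι → ℝ :=
  open Classical in N.linearResponse W fun v a => if v = s a then 1 else 0

/-- Node functions in the analytic class are identifiable when, for each node, the linearization at
the zero excitation transfers excitations onto the in-neighbours surjectively. -/
theorem identifiable_of_det_ne_zero [Finite V] {Φ : N.NodeFunctions} (hΦ : ∀ i, IsClassFA (Φ i))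
    (s : ∀ i, N.InNbr i → V) (hs : ∀ i j, s i j ∈ N.excited)
    (hdet : ∀ i, (Matrix.of fun j : N.InNbr i => N.transfer (s i) (N.gain Φ 0) j.1).det ≠ 0) :
    N.Identifiable Φ := by
  classical
  intro Ψ hΨ hm
  have hout : ∀ u i k, N.output Ψ u i k = N.output Φ u i k := fun u i k => by
    have := congr_fun (congr_fun (congr_fun hm i) u) k
    simpa [measured] using this
  funext i
  let T : (N.InNbr i → ℝ) →ₗ[ℝ] ((N.InNbr i → ℝ) →L[ℝ] ℝ) :=
    { toFun := fun c => ∑ j, c j • ContinuousLinearMap.proj j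
      map_add' := fun c d => by simp [add_smul, Finset.sum_add_distrib]
      map_smul' := fun r c => by simp [mul_smul, Finset.smul_sum] }
  have hT : ∀ c x, T c x = ∑ j, c j * x j := fun c x => by simp [T]
  -- The coordinate `x j` is the constant excitation applied at `s i j`.
  let e : V → (N.InNbr i → ℝ) →L[ℝ] ℝ := fun v => T fun j => if v = s i j then 1 else 0
  have he : ∀ x v, v ∉ N.excited → e v x = 0 := fun x v hv => by
    refine (hT _ _).trans (Finset.sum_eq_zero fun j _ => ?_)
    have : v ≠ s i j := fun h => hv (h.symm ▸ hs i j)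
    simp [this]
  let Y : (N.InNbr i → ℝ) → (N.InNbr i → ℝ) := fun x j => N.staticOutput Φ (fun v => e v x) j.1
  have hagree : ∀ x, Ψ i (Y x) = Φ i (Y x) := fun x => by
    have h0 := hout (fun v _ => e v.1 x) i 0
    rw [output_eq, output_eq] at h0
    have h1 := add_left_cancel h0
    simp_rw [hout, N.output_const Φ (he x)] at h1
    exact h1
  have hY : HasStrictFDerivAt Y (ContinuousLinearMap.pi fun j : N.InNbr i =>
      N.linearResponse (N.gain Φ fun v => e v 0) e j.1) 0 :=
    hasStrictFDerivAt_pi'.2 fun j => N.hasStrictFDerivAt_staticOutput hΦ e 0 j.1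
  have hsurj : (ContinuousLinearMap.pi fun j : N.InNbr i =>
      N.linearResponse (N.gain Φ fun v => e v 0) e j.1).range = ⊤ := by
    refine LinearMap.range_eq_top.2 fun y => ?_
    obtain ⟨x, hx⟩ := (Matrix.mulVec_surjective_iff_isUnit.2
      ((Matrix.isUnit_iff_isUnit_det _).2 (isUnit_iff_ne_zero.2 (hdet i)))) y
    refine ⟨x, ?_⟩
    rw [← hx]
    ext j
    have hz : (fun v => e v 0) = (0 : V → ℝ) := by ext v; simp
    have := N.map_linearResponse T (N.gain Φ 0)
      (fun v j => if v = s i j then (1 : ℝ) else 0) j.1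
    simp only [ContinuousLinearMap.coe_coe, ContinuousLinearMap.pi_apply, hz]
    change N.linearResponse _ (fun v => T _) _ _ = _
    rw [← this, hT]
    rfl
  -- A surjective strict derivative makes `Y` locally open, so agreement on its values is agreement
  -- near `Y 0`.
  have hmap := hY.map_nhds_eq_of_surj hsurj
  refine AnalyticOnNhd.eq_of_eventuallyEq (hΨ i) (hΦ i) (z₀ := Y 0) ?_
  rw [Filter.EventuallyEq, ← hmap, Filter.eventually_map]
  exact Filter.Eventually.of_forall hagree

/-! ### Gains supported on disjoint paths -/

/-- Gains that are one along a family of disjoint paths and zero on the other arrows transfer the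
excitations of the initial nodes onto the respective final nodes. -/
theorem exists_gain_transfer_det_ne_zero [Finite V] {i : V} {p : N.InNbr i → List V}
    {s : N.InNbr i → V} (hp : ∀ j, N.IsPath (p j) (s j) j.1)
    (hdisj : ∀ j j', j ≠ j' → (p j).Disjoint (p j')) :
    ∃ W, (Matrix.of fun j : N.InNbr i => N.transfer s W j.1).det ≠ 0 := by
  classical
  -- A vertex lies on at most one path, in only one position.
  have huniq : ∀ {j j' : N.InNbr i} {n n' : ℕ} {v : V}, (p j)[n]? = some v →
      (p j')[n']? = some v → j = j' ∧ n = n' := by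
    intro j j' n n' v h h'
    have hj : j = j' := by
      by_contra hne
      exact hdisj j j' hne (List.mem_of_getElem? h) (List.mem_of_getElem? h')
    subst hj
    obtain ⟨hn, hv⟩ := List.getElem?_eq_some_iff.1 h
    obtain ⟨hn', hv'⟩ := List.getElem?_eq_some_iff.1 h'
    exact ⟨rfl, (hp j).2.1.getElem_inj_iff.1 (hv.trans hv'.symm)⟩
  have hhead : ∀ j, (p j)[0]? = some (s j) := fun j => by
    rw [← List.head?_eq_getElem?]; exact (hp j).2.2.1
  let W : ∀ v, N.InNbr v → ℝ := fun v b =>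
    if ∃ j n, (p j)[n]? = some b.1 ∧ (p j)[n + 1]? = some v then 1 else 0
  refine ⟨W, ?_⟩
  -- The only active arrow into a path vertex comes from its predecessor, so the unit response is
  -- carried unchanged along the path.
  have key : ∀ (j : N.InNbr i) (n : ℕ) (v : V), (p j)[n]? = some v → N.transfer s W v = Pi.single j 1 := by
    intro j n
    induction n with
    | zero =>
      intro v hv
      rw [transfer, linearResponse_eq, Finset.sum_eq_zero, add_zero]
      · ext a
        obtain rfl : v = s j := by simpa [hv] using hhead j
        have : s j = s a ↔ a = j := ⟨fun h => (huniq (hhead a) (h ▸ hhead j)).1, fun h => by rw [h]⟩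
        simp [this, Pi.single_apply]
      · intro b _
        have : ¬ ∃ j n, (p j)[n]? = some b.1 ∧ (p j)[n + 1]? = some v := by
          rintro ⟨j', n', -, h⟩
          exact absurd (huniq hv h).2 (by omega)
        simp [W, this]
    | succ n ih =>
      intro v hv
      obtain ⟨hn, hv'⟩ := List.getElem?_eq_some_iff.1 hv
      have hb : (p j)[n]? = some (p j)[n] := List.getElem?_eq_getElem (by omega)
      have hadj : N.graph.Adj (p j)[n] v := hv' ▸ List.isChain_iff_getElem.1 (hp j).1 n hn
      rw [transfer, linearResponse_eq, Finset.sum_eq_single ⟨_, hadj⟩]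
      · have h1 : W v ⟨_, hadj⟩ = 1 := if_pos ⟨j, n, hb, hv⟩
        have h2 := ih _ hb
        rw [transfer] at h2
        rw [h1, one_smul, h2]
        ext a
        have : v ≠ s a := fun h => absurd (huniq hv (h ▸ hhead a)).2 (by omega)
        simp [this]
      · intro b _ hne
        have : ¬ ∃ j n, (p j)[n]? = some b.1 ∧ (p j)[n + 1]? = some v := by
          rintro ⟨j', n', h, h'⟩
          obtain ⟨rfl, hnn⟩ := huniq hv h'
          obtain rfl : n = n' := by omega
          exact hne (Subtype.ext (Option.some.inj (h.symm.trans hb)))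
        simp [W, this]
      · exact fun h => absurd (Finset.mem_univ _) h
  have hone : (Matrix.of fun j : N.InNbr i => N.transfer s W j.1) = 1 := by
    ext j a
    have := key j ((p j).length - 1) j.1 (by
      rw [← List.getLast?_eq_getElem?]; exact (hp j).2.2.2)
    rw [Matrix.of_apply, this, Pi.single_apply, Matrix.one_apply]
    simp [eq_comm]
  rw [hone, Matrix.det_one]
  exact one_ne_zero

/-! ### Dependence of the gains on the parameters -/

theorem isClassFA_nodeFunctions [Finite V] {K : ℕ} (R : N.Remainder K) (α : N.Params K) (i : V) :
    IsClassFA (N.nodeFunctions R α i) := by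
  intro y _
  have hproj : ∀ j, AnalyticAt ℝ (fun y : N.InNbr i → ℝ => y j) y := fun j =>
    (ContinuousLinearMap.proj (R := ℝ) (φ := fun _ : N.InNbr i => ℝ) j).analyticAt y
  refine AnalyticAt.add (Finset.analyticAt_fun_sum _ fun j _ => AnalyticAt.add
    (Finset.analyticAt_fun_sum _ fun l _ => analyticAt_const.mul ((hproj j).pow _)) ?_)
    (R.mixed_analytic i y (mem_univ _))
  exact (R.tail_analytic i j (y j) (mem_univ _)).comp (f := fun y : N.InNbr i → ℝ => y j) (hproj j)

/-- The contribution of the remainder to the partial derivatives of the node functions. -/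
noncomputable def remainderGain [Finite V] {K : ℕ} (R : N.Remainder K) (i : V)
    (y : N.InNbr i → ℝ) (j : N.InNbr i) : ℝ :=
  deriv (R.tail i j) (y j) + fderiv ℝ (R.mixed i) y (Pi.single j 1)

theorem analyticAt_remainderGain [Finite V] {K : ℕ} (R : N.Remainder K) (i : V)
    (y : N.InNbr i → ℝ) (j : N.InNbr i) :
    AnalyticAt ℝ (fun y => N.remainderGain R i y j) y := by
  refine AnalyticAt.add ?_ ?_
  · exact ((R.tail_analytic i j).deriv (y j) (mem_univ _)).comp
      (f := fun y : N.InNbr i → ℝ => y j)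
      ((ContinuousLinearMap.proj (R := ℝ) (φ := fun _ : N.InNbr i => ℝ) j).analyticAt y)
  · exact (ContinuousLinearMap.analyticAt
      (ContinuousLinearMap.apply ℝ ℝ (Pi.single j (1 : ℝ) : N.InNbr i → ℝ)) _).comp
      ((R.mixed_analytic i).fderiv y (mem_univ _))

theorem gain_nodeFunctions [Finite V] (R : N.Remainder 1) (α : N.Params 1) (z : V → ℝ) (i : V)
    (j : N.InNbr i) :
    N.gain (N.nodeFunctions R α) z i j = α i j 0 + N.remainderGain R i
      (fun j => N.staticOutput (N.nodeFunctions R α) z j.1) j := by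
  unfold gain
  generalize (fun j : N.InNbr i => N.staticOutput (N.nodeFunctions R α) z j.1) = y
  have hproj : ∀ j, HasFDerivAt (fun y : N.InNbr i → ℝ => y j)
      (ContinuousLinearMap.proj (R := ℝ) (φ := fun _ : N.InNbr i => ℝ) j) y := fun j =>
    (ContinuousLinearMap.proj (R := ℝ) (φ := fun _ : N.InNbr i => ℝ) j).hasFDerivAt
  have h : HasFDerivAt (N.nodeFunctions R α i)
      (∑ j, (α i j 0 • ContinuousLinearMap.proj (R := ℝ) (φ := fun _ : N.InNbr i => ℝ) j +
        deriv (R.tail i j) (y j) • ContinuousLinearMap.proj (R := ℝ) (φ := fun _ : N.InNbr i => ℝ) j)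
        + fderiv ℝ (R.mixed i) y) y := by
    have h' : N.nodeFunctions R α i =
        fun y => ∑ j, (α i j 0 * y j + R.tail i j (y j)) + R.mixed i y := by
      ext y
      simp [nodeFunctions]
    rw [h']
    refine HasFDerivAt.add (HasFDerivAt.fun_sum fun j _ => ((hproj j).const_mul _).add ?_)
      (R.mixed_analytic i y (mem_univ _)).differentiableAt.hasFDerivAt
    exact (R.tail_analytic i j (y j) (mem_univ _)).differentiableAt.hasDerivAt.comp_hasFDerivAt y
      (hproj j)
  rw [h.fderiv]
  simp only [add_apply, sum_apply,
    smul_apply, ContinuousLinearMap.proj_apply, remainderGain]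
  rw [Finset.sum_eq_single j (fun k _ hk => by simp [Pi.single_eq_of_ne hk]) (by simp)]
  simp [add_assoc]

theorem analyticAt_param [Fintype V] {K : ℕ} (i : V) (j : N.InNbr i) (l : Fin K)
    (α : N.Params K) : AnalyticAt ℝ (fun α : N.Params K => α i j l) α :=
  ((ContinuousLinearMap.proj (R := ℝ) (φ := fun _ : Fin K => ℝ) l).comp
    ((ContinuousLinearMap.proj (R := ℝ) (φ := fun _ : N.InNbr i => Fin K → ℝ) j).comp
      (ContinuousLinearMap.proj (R := ℝ) (φ := fun i => N.InNbr i → Fin K → ℝ) i))).analyticAt α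

theorem analyticAt_staticOutput_nodeFunctions [Fintype V] {K : ℕ} (R : N.Remainder K) (z : V → ℝ)
    (i : V) (α : N.Params K) :
    AnalyticAt ℝ (fun α => N.staticOutput (N.nodeFunctions R α) z i) α := by
  induction i using N.wellFounded_adj.induction with
  | _ i ih =>
    simp_rw [N.staticOutput_eq _ _ i]
    refine analyticAt_const.add (AnalyticAt.add
      (Finset.analyticAt_fun_sum _ fun j _ => AnalyticAt.add
        (Finset.analyticAt_fun_sum _ fun l _ => AnalyticAt.mul ?_ ((ih j.1 j.2).pow _)) ?_) ?_)
    · exact N.analyticAt_param i j l α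
    · exact (R.tail_analytic i j _ (mem_univ _)).comp (ih j.1 j.2)
    · exact (R.mixed_analytic i _ (mem_univ _)).comp
        (f := fun α => fun j : N.InNbr i => N.staticOutput (N.nodeFunctions R α) z j.1)
        (AnalyticAt.pi fun j => ih j.1 j.2)

theorem analyticAt_gain_nodeFunctions [Fintype V] (R : N.Remainder 1) (z : V → ℝ) (i : V)
    (j : N.InNbr i) (α : N.Params 1) :
    AnalyticAt ℝ (fun α => N.gain (N.nodeFunctions R α) z i j) α := by
  simp_rw [gain_nodeFunctions]
  refine (N.analyticAt_param i j 0 α).add ?_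
  exact (N.analyticAt_remainderGain R i _ j).comp
    (f := fun α => fun j : N.InNbr i => N.staticOutput (N.nodeFunctions R α) z j.1)
    (AnalyticAt.pi fun k => N.analyticAt_staticOutput_nodeFunctions R z k.1 α)

/-- Every family of gains is realized by some choice of the linear coefficients. -/
theorem exists_gain_nodeFunctions_eq [Finite V] (R : N.Remainder 1) (z : V → ℝ)
    (W : ∀ i, N.InNbr i → ℝ) : ∃ α : N.Params 1, N.gain (N.nodeFunctions R α) z = W := by
  -- The coefficients needed depend on the outputs, which depend on the coefficients. Letting the
  -- coefficients vary with the state breaks the circle: freezing them at the resulting outputs `y`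
  -- leaves `y` a solution.
  let Ψ : N.NodeFunctions := fun i y =>
    ∑ j, ((W i j - N.remainderGain R i y j) * y j + R.tail i j (y j)) + R.mixed i y
  let y := N.staticOutput Ψ z
  let α : N.Params 1 := fun i j _ => W i j - N.remainderGain R i (fun k => y k.1) j
  have hy : y = N.staticOutput (N.nodeFunctions R α) z :=
    N.eq_staticOutput fun i => by
      change N.staticOutput Ψ z i = _
      rw [staticOutput_eq]
      simp [Ψ, nodeFunctions, α, y]
  refine ⟨α, ?_⟩
  ext i j
  rw [gain_nodeFunctions, ← hy]
  simp [α]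

theorem gain_nodeFunctions_of_mixed_zero [Finite V] (R : N.Remainder 1)
    (hR : ∀ i, R.mixed i 0 = 0) (α : N.Params 1) :
    N.gain (N.nodeFunctions R α) 0 = fun i j => α i j 0 := by
  have h0 : (0 : V → ℝ) = N.staticOutput (N.nodeFunctions R α) 0 :=
    N.eq_staticOutput fun i => by
      have ht : ∀ j, R.tail i j 0 = 0 := fun j => by
        simpa using R.tail_order i j 0 (by omega)
      have hm : R.mixed i (fun _ => 0) = 0 := hR i
      simp [nodeFunctions, ht, hm]
  ext i j
  rw [gain_nodeFunctions, ← h0]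
  have ht : deriv (R.tail i j) 0 = 0 := by
    simpa using R.tail_order i j 1 le_rfl
  -- `mixed i` is constant along each axis, so its partial derivatives at the origin vanish.
  have hm : fderiv ℝ (R.mixed i) 0 (Pi.single j 1) = 0 := by
    have h1 : HasDerivAt (fun t : ℝ => t • (Pi.single j 1 : N.InNbr i → ℝ)) (Pi.single j 1) 0 := by
      simpa using (hasDerivAt_id (0 : ℝ)).smul_const (Pi.single j 1 : N.InNbr i → ℝ)
    have h2 : HasFDerivAt (R.mixed i) (fderiv ℝ (R.mixed i) 0)
        ((0 : ℝ) • (Pi.single j 1 : N.InNbr i → ℝ)) := by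
      rw [zero_smul]
      exact (R.mixed_analytic i 0 (mem_univ _)).differentiableAt.hasFDerivAt
    refine (h2.comp_hasDerivAt (0 : ℝ) h1).unique ?_
    have : R.mixed i ∘ (fun t : ℝ => t • (Pi.single j 1 : N.InNbr i → ℝ)) =
        fun _ => R.mixed i 0 := by
      ext t
      rw [Function.comp_apply, ← R.mixed_axis i j t, ← Pi.single_smul, smul_eq_mul, mul_one]
    rw [this]
    exact hasDerivAt_const _ _
  change α i j 0 + (deriv (R.tail i j) 0 + fderiv ℝ (R.mixed i) 0 (Pi.single j 1)) = _
  rw [ht, hm, add_zero, add_zero]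

/-- Gains that depend analytically on the parameters and take all values have, for almost all
parameters, a nonsingular matrix of transfer gains onto the in-neighbours of `i`, if there are
disjoint paths to these. -/
theorem ae_det_transfer_ne_zero [Fintype V] {K : ℕ} {i : V} {p : N.InNbr i → List V}
    {s : N.InNbr i → V} (hp : ∀ j, N.IsPath (p j) (s j) j.1)
    (hdisj : ∀ j j', j ≠ j' → (p j).Disjoint (p j'))
    {G : N.Params K → ∀ i, N.InNbr i → ℝ}
    (hG : ∀ i j α, AnalyticAt ℝ (fun α => G α i j) α) (hsurj : ∀ W, ∃ α, G α = W) :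
    ∀ᵐ α : N.Params K, (Matrix.of fun j : N.InNbr i => N.transfer s (G α) j.1).det ≠ 0 := by
  have hvol : (volume : Measure (N.Params K)).IsAddHaarMeasure := by
    have h (i : V) : (volume : Measure (N.InNbr i → Fin K → ℝ)).IsAddHaarMeasure :=
      Measure.pi.isAddHaarMeasure _
    exact Measure.pi.isAddHaarMeasure _
  refine ae_ne_zero_of_analyticOnNhd volume (fun α _ => ?_) ?_
  · simp_rw [Matrix.det_apply']
    refine Finset.analyticAt_fun_sum _ fun σ _ => analyticAt_const.mul
      (Finset.analyticAt_fun_prod _ fun j _ => ?_)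
    exact (ContinuousLinearMap.proj (R := ℝ) (φ := fun _ : N.InNbr i => ℝ) j).analyticAt _ |>.comp
      (N.analyticAt_linearResponse (fun i j => hG i j α) _ _)
  · obtain ⟨W, hW⟩ := N.exists_gain_transfer_det_ne_zero hp hdisj
    obtain ⟨α, rfl⟩ := hsurj W
    exact ⟨α, hW⟩

end Network

theorem theorem1 {V : Type*} [Fintype V] (N : Network V)
    (hdelay : N.PathIndependentDelay)
    (hpaths : ∀ i, N.HasVertexDisjointPaths i) :
    ∃ K : ℕ, 1 ≤ K ∧ N.KGenericallyIdentifiable K ∧ N.UniformlyKGenericallyIdentifiable K := by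
  choose p hp hdisj using hpaths
  choose s hs hp using hp
  refine ⟨1, le_rfl, fun R => ?_, ?_⟩
  · have h := MeasureTheory.ae_all_iff.2 fun i => N.ae_det_transfer_ne_zero (hp i) (hdisj i)
      (N.analyticAt_gain_nodeFunctions R 0) (N.exists_gain_nodeFunctions_eq R 0)
    filter_upwards [h] with α hα
    exact N.identifiable_of_det_ne_zero (N.isClassFA_nodeFunctions R α) s hs hα
  · have h := MeasureTheory.ae_all_iff.2 fun i => N.ae_det_transfer_ne_zero (K := 1)
      (G := fun α i j => α i j 0) (hp i) (hdisj i) (fun i j => N.analyticAt_param i j 0)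
      (fun W => ⟨fun i j _ => W i j, rfl⟩)
    filter_upwards [h] with α hα R hR
    refine N.identifiable_of_det_ne_zero (N.isClassFA_nodeFunctions R α) s hs ?_
    rwa [N.gain_nodeFunctions_of_mixed_zero R hR α]
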